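/- **Setting.** Let $\mathcal E$ be a finite set of experts, $\mathcal C$ a finite set of concepts, and $\mathcal T$ a nonempty finite family of candidate teams $\mathcal S\subseteq\mathcal E$ with $|\mathcal S|\ge 2$. Experts have capability vectors $\mathbf v_e\in\mathbb R_{+}^{\mathcal C}$, the task of round $t$ has a requirement vector $\mathbf d^t\in\mathbb R_{+}^{\mathcal C}$ and a difficulty $d_t\ge 0$ (bounded in $t$), and the knowledge graph has a finite set of dependency edges between concepts. Let $\mathcal C_{\mathcal S}$ be the set of concepts in which some $e\in\mathcal S$ has positive capability, $\mathcal C_t$ the set of concepts with positive requirement in $\mathbf d^t$, $\rho(\mathcal S,t)=|\mathcal C_{\mathcal S}\cap\mathcal C_t|/|\mathcal C_{\mathcal S}\cup\mathcal C_t|$ (with $0/0=0$), $R_{\rm dep}(\mathcal S,t)$ the set of dependency edges between $\mathcal C_{\mathcal S}$ and $\mathcal C_t$, and $$\mathrm{Synergy}(\mathcal S)=\frac{1}{|\mathcal S|(|\mathcal S|-1)}\sum_{e\ne e'\in\mathcal S}\mathcal C_{\rm syn}(e,e')\in[0,1].$$ Let $r_{\mathcal S}^{(t)}\in[0,1]$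 be the feedback on $\mathcal S$ in round $t$ and $\bar H_{\mathcal S}(t)$ the average of the feedback on $\mathcal S$ before round $t$ ($0$ in the first round). With weights satisfying $\sum_i\omega_i=1$, put $$\mathrm{Dist}(\mathcal S,t)=\log(1+d_t)\Big[\omega_1(1-\rho(\mathcal S,t))+\omega_2\tfrac{|R_{\rm dep}(\mathcal S,t)|}{|\mathcal E|}+\omega_3(1-\bar H_{\mathcal S}(t))+\omega_4(1-\mathrm{Synergy}(\mathcal S))\Big],\qquad \mathrm{KM}(\mathcal S,t)=\rho(\mathcal S,t)\,\mathrm{Synergy}(\mathcal S).$$ Fix $\delta\ge0$, time steps $\Delta t>0$ (they may depend on $t$ and are bounded) and positive initial values $\alpha_{\mathcal S},\beta_{\mathcal S}$. For every team and every round, $$\alpha_{\mathcal S}^{(t+1)}=\gamma^{\Delta t}\alpha_{\mathcal S}^{(t)}+r_{\mathcal S}^{(t)}+\delta\,\mathrm{KM}(\mathcal S,t),\qquad \beta_{\mathcal S}^{(t+1)}=\gamma^{\Delta t}\beta_{\mathcal S}^{(t)}+1-r_{\mathcal S}^{(t)}+\delta\,(1-\mathrm{KM}(\mathcal S,t)).$$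 Model: conditionally on the history up to round $t$ (which determines the past feedback), the success probability $\theta_{\mathcal S}^{(t)}$ of team $\mathcal S$ has the law $\mathrm{Beta}(\alpha_{\mathcal S}^{(t)},\beta_{\mathcal S}^{(t)})$; nothing else is assumed about the joint law of the success probabilities and the feedback. The strategy selects in round $t$ a team $\mathcal S_t$ that maximizes $$x_{\mathcal S}\cdot e^{-\lambda\,\mathrm{Dist}(\mathcal S,t)}\cdot\gamma^{\Delta t}\cdot\mathrm{Synergy}(\mathcal S)^{\eta},$$ where $x_{\mathcal S}$ is either, given the history, a draw from $\mathrm{Beta}(\alpha_{\mathcal S}^{(t)},\beta_{\mathcal S}^{(t)})$ (Thompson sampling), or its mean $\alpha_{\mathcal S}^{(t)}/(\alpha_{\mathcal S}^{(t)}+\beta_{\mathcal S}^{(t)})$; ties are broken in any way, and $0^0=1$. For a benchmark $\mathcal S^*$ (a fixed team, or a possibly random team for each round, for instance the best one) let $$\mathcal R(T)=\sum_{t=1}^{T}\big[\theta_{\mathcal S^*}^{(t)}-\theta_{\mathcal S_t}^{(t)}\big].$$ **Theorem ($\epsilon$-approximate optimal convergence).** There is a constant $K$, depending only on the system data above, such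 that for every $\epsilon>0$ there are parameters $\lambda^*>0$, $\eta^*\ge0$, $\gamma^*\in(0,1)$, with $\eta^*>0$ if all teams have positive synergy, such that for every run of the strategy with either choice of $x_{\mathcal S}$ and for every benchmark $\mathcal S^*$: 1. $\mathbb E[\mathcal R(T)]\le\epsilon T+K\sqrt{T\log T}$ for all $T\ge2$; 2. if moreover the history of each round includes the success probabilities of all the earlier rounds, then almost surely $\mathcal R(T)\le\epsilon T+K\sqrt{T\log T}$ for all sufficiently large $T$. -/

import Mathlib

open MeasureTheory ProbabilityTheory Filter

namespace KABB

noncomputable section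

/-- `Synergy(S)`: the average of the pairwise synergy gain coefficients `C_syn` over the
`|S| (|S| - 1)` ordered pairs of distinct experts of `S`. -/
def synergyOf {E : Type*} [DecidableEq E] (csyn : E → E → ℝ) (S : Finset E) : ℝ :=
  (∑ p ∈ S.offDiag, csyn p.1 p.2) / ((S.card : ℝ) * ((S.card : ℝ) - 1))

/-- The data of a KABB system with expert set `E` and concept set `C`.  Rounds are numbered
`0, 1, 2, …`, so `T` steps are the rounds `t < T`. -/
structure System (E C : Type*) [Fintype E] [DecidableEq E] [Fintype C] [DecidableEq C] where
  /-- the candidate teams -/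
  teams : Finset (Finset E)
  teams_nonempty : teams.Nonempty
  /-- a team has at least two members, so that its synergy is defined -/
  two_le_card : ∀ S ∈ teams, 2 ≤ S.card
  /-- capability vector `v_e` of every expert -/
  capability : E → C → ℝ
  capability_nonneg : ∀ e c, 0 ≤ capability e c
  /-- requirement vector of the task of round `t` -/
  requirement : ℕ → C → ℝ
  requirement_nonneg : ∀ t c, 0 ≤ requirement t c
  /-- dependency edges of the knowledge graph -/
  depEdges : Finset (C × C)
  /-- difficulty coefficient `d_t` of the task of round `t` -/
  difficulty : ℕ → ℝ
  difficulty_nonneg : ∀ t, 0 ≤ difficulty t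
  difficulty_bdd : BddAbove (Set.range difficulty)
  /-- weights `ω₁, …, ω₄` of the knowledge distance -/
  weight : Fin 4 → ℝ
  weight_sum : ∑ i, weight i = 1
  /-- pairwise synergy gain coefficients -/
  csyn : E → E → ℝ
  synergy_mem : ∀ S ∈ teams, synergyOf csyn S ∈ Set.Icc (0 : ℝ) 1
  /-- strength `δ` of the knowledge matching correction -/
  delta : ℝ
  delta_nonneg : 0 ≤ delta
  /-- time `Δt` elapsed between round `t` and round `t + 1` -/
  dt : ℕ → ℝ
  dt_pos : ∀ t, 0 < dt t
  dt_bdd : BddAbove (Set.range dt)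
  /-- initial Beta parameters -/
  alpha0 : {S // S ∈ teams} → ℝ
  beta0 : {S // S ∈ teams} → ℝ
  alpha0_pos : ∀ S, 0 < alpha0 S
  beta0_pos : ∀ S, 0 < beta0 S

/-- The tunable parameters `(λ, η, γ)`. -/
structure Params where
  lam : ℝ
  eta : ℝ
  gam : ℝ

namespace System

variable {E C : Type*} [Fintype E] [DecidableEq E] [Fintype C] [DecidableEq C]

/-- A candidate team. -/
abbrev Team (sys : System E C) : Type _ := {S // S ∈ sys.teams}

/-- Concepts `C_S` covered by the team `S`. -/
def teamConcepts (sys : System E C) (S : sys.Team) : Finset C :=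
  Finset.univ.filter fun c => ∃ e ∈ S.1, 0 < sys.capability e c

/-- Concepts `C_t` required by the task of round `t`. -/
def taskConcepts (sys : System E C) (t : ℕ) : Finset C :=
  Finset.univ.filter fun c => 0 < sys.requirement t c

/-- Jaccard similarity `ρ_overlap(S, t)`. -/
def overlap (sys : System E C) (S : sys.Team) (t : ℕ) : ℝ :=
  ((sys.teamConcepts S ∩ sys.taskConcepts t).card : ℝ) /
    ((sys.teamConcepts S ∪ sys.taskConcepts t).card : ℝ)

/-- `R_dep(S, t)`: the dependency edges between the concepts of the team and those of the task. -/
def depBetween (sys : System E C) (S : sys.Team) (t : ℕ) : Finset (C × C) :=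
  sys.depEdges.filter fun p =>
    (p.1 ∈ sys.teamConcepts S ∧ p.2 ∈ sys.taskConcepts t) ∨
      (p.2 ∈ sys.teamConcepts S ∧ p.1 ∈ sys.taskConcepts t)

/-- `Synergy(S)`. -/
def synergy (sys : System E C) (S : sys.Team) : ℝ := synergyOf sys.csyn S.1

/-- Average historical success rate of `S` before round `t`, for the feedback `r`
(it is `0` when there is no history yet). -/
def histRate (sys : System E C) (r : ℕ → sys.Team → ℝ) (S : sys.Team) (t : ℕ) : ℝ :=
  (∑ s ∈ Finset.range t, r s S) / (t : ℝ)

/-- The knowledge distance `Dist(S, t)`. -/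
def dist (sys : System E C) (r : ℕ → sys.Team → ℝ) (S : sys.Team) (t : ℕ) : ℝ :=
  Real.log (1 + sys.difficulty t) *
    (sys.weight 0 * (1 - sys.overlap S t) +
      sys.weight 1 * (((sys.depBetween S t).card : ℝ) / (Fintype.card E : ℝ)) +
      sys.weight 2 * (1 - sys.histRate r S t) +
      sys.weight 3 * (1 - sys.synergy S))

/-- The knowledge matching index `KM(S, t)`. -/
def km (sys : System E C) (S : sys.Team) (t : ℕ) : ℝ := sys.overlap S t * sys.synergy S

/-- The decayed update of the first Beta parameter. -/
def alpha (sys : System E C) (par : Params) (r : ℕ → sys.Team → ℝ) : ℕ → sys.Team → ℝ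
  | 0, S => sys.alpha0 S
  | t + 1, S => par.gam ^ sys.dt t * sys.alpha par r t S + r t S + sys.delta * sys.km S t

/-- The decayed update of the second Beta parameter. -/
def beta (sys : System E C) (par : Params) (r : ℕ → sys.Team → ℝ) : ℕ → sys.Team → ℝ
  | 0, S => sys.beta0 S
  | t + 1, S =>
      par.gam ^ sys.dt t * sys.beta par r t S + (1 - r t S) + sys.delta * (1 - sys.km S t)

/-- The expectation `α / (α + β)` of the Beta law of round `t`. -/
def betaMean (sys : System E C) (par : Params) (r : ℕ → sys.Team → ℝ) (t : ℕ) (S : sys.Team) : ℝ :=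
  sys.alpha par r t S / (sys.alpha par r t S + sys.beta par r t S)

/-- The reweighted confidence of the team `S` in round `t` when its success probability is
estimated by `x`: `x · exp (-λ Dist(S, t)) · γ^Δt · Synergy(S)^η`. -/
def confidence (sys : System E C) (par : Params) (r : ℕ → sys.Team → ℝ) (t : ℕ) (S : sys.Team)
    (x : ℝ) : ℝ :=
  x * Real.exp (-par.lam * sys.dist r S t) * par.gam ^ sys.dt t * sys.synergy S ^ par.eta

end System

/-- Conditionally on the sub-σ-algebra `m`, the random variable `X` has the Beta law with the
(`m`-measurable) random parameters `a`, `b`. -/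
def HasCondBetaLaw {Ω : Type*} {mΩ : MeasurableSpace Ω} (μ : Measure Ω) (m : MeasurableSpace Ω)
    (X a b : Ω → ℝ) : Prop :=
  ∀ A : Set Ω, MeasurableSet[m] A → ∀ B : Set ℝ, MeasurableSet B →
    μ (A ∩ X ⁻¹' B) = ∫⁻ ω in A, betaMeasure (a ω) (b ω) B ∂μ

/-- What the strategy reweights: a draw from the current Beta law of every team
(Thompson sampling), or the expectation of that law. -/
inductive Rule
  | draw
  | mean

/-- A run of the strategy on a probability space.  `history t` is the information available at the
start of round `t`.  The feedback may have any law on `[0, 1]` (for instance Bernoulli with the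
success probability as its parameter), and no joint law is prescribed for different teams or for
the draws and the success probabilities (conditional independence is a special case). -/
structure Run {E C : Type*} [Fintype E] [DecidableEq E] [Fintype C] [DecidableEq C]
    (sys : System E C) (par : Params) (rule : Rule)
    {Ω : Type*} {mΩ : MeasurableSpace Ω} (μ : Measure Ω) where
  history : Filtration ℕ mΩ
  /-- success probability `θ_S^{(t)}` -/
  theta : ℕ → Ω → sys.Team → ℝ
  /-- feedback `r_S^{(t)}` -/
  reward : ℕ → Ω → sys.Team → ℝ
  /-- the estimates of the success probabilities that enter the confidence -/
  est : ℕ → Ω → sys.Team → ℝ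
  /-- the selected team `S_t` -/
  selected : ℕ → Ω → sys.Team
  measurable_theta : ∀ t S, Measurable fun ω => theta t ω S
  measurable_reward : ∀ t S, Measurable[history (t + 1)] fun ω => reward t ω S
  measurable_est : ∀ t S, Measurable[history (t + 1)] fun ω => est t ω S
  measurable_selected : ∀ t S, MeasurableSet[history (t + 1)] {ω | selected t ω = S}
  reward_mem : ∀ t ω S, reward t ω S ∈ Set.Icc (0 : ℝ) 1
  /-- the model: given the history, `θ_S^{(t)} ∼ Beta(α_S^{(t)}, β_S^{(t)})` -/
  theta_law : ∀ t S, HasCondBetaLaw μ (history t) (fun ω => theta t ω S)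
    (fun ω => sys.alpha par (fun s => reward s ω) t S)
    (fun ω => sys.beta par (fun s => reward s ω) t S)
  est_law : match rule with
    | Rule.draw => ∀ t S, HasCondBetaLaw μ (history t) (fun ω => est t ω S)
        (fun ω => sys.alpha par (fun s => reward s ω) t S)
        (fun ω => sys.beta par (fun s => reward s ω) t S)
    | Rule.mean => ∀ t S ω, est t ω S = sys.betaMean par (fun s => reward s ω) t S
  /-- the selected team has maximal confidence, ties being broken in any way -/
  selected_max : ∀ t ω S,
    sys.confidence par (fun s => reward s ω) t S (est t ω S) ≤
      sys.confidence par (fun s => reward s ω) t (selected t ω) (est t ω (selected t ω))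

/-- The cumulative regret `R(T) = ∑_t [θ_{S*}^{(t)} - θ_{S_t}^{(t)}]` against the benchmark `opt`. -/
def Run.regret {E C : Type*} [Fintype E] [DecidableEq E] [Fintype C] [DecidableEq C]
    {sys : System E C} {par : Params} {rule : Rule}
    {Ω : Type*} {mΩ : MeasurableSpace Ω} {μ : Measure Ω} (run : Run sys par rule μ)
    (opt : ℕ → Ω → sys.Team) (T : ℕ) (ω : Ω) : ℝ :=
  ∑ t ∈ Finset.range T, (run.theta t ω (opt t ω) - run.theta t ω (run.selected t ω))

end

end KABB

/-! No learning argument is needed: with `γ` close to 1 the Beta laws become narrow, and with `λ`,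
`η` close to 0 the strategy is nearly greedy for the Beta means. In one round the regret is at most
a reweighting error `exp (3 s) - 1` plus twice the total deviation, over all teams, of the success
probabilities and of the estimates from these means (`Run.ae_regret_le`). Summing over all teams
removes any need for independence, or for control of how the benchmark and the selection depend on
the randomness.

A Beta law deviates from its mean by at most `1 / √(α + β)` on average
(`lintegral_abs_sub_betaMeasure_le`). Whatever the feedback, each round adds `1 + δ` to `α + β`; if
`γ^Δt ≥ 1 - 1 / (2 M)`, the total weight is at least of order `min (t + 1) M`
(`geom_sum_le_alpha_add_beta`, `half_min_le_geom_sum`). Hence the deviations sum to `O(√T + T / √M)`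
in expectation. The `√T` part has a constant free of `ε` and goes into `K`; a large `M` makes the
linear part small.

For the almost sure bound, conditioning round by round controls the exponential moment of the
accumulated deviation (`lintegral_exp_sum_abs_sub_le`). Markov's inequality then gives geometric
tails, and Borel–Cantelli concludes. -/

namespace KABB

/-! ### Beta laws: measurability and concentration around the mean. -/

open scoped ENNReal

/-- The reciprocal of the complex Gamma function is entire, so Gamma is the inverse of a continuous
function, poles included. -/
theorem measurable_gamma : Measurable Real.Gamma := by
  have h : Real.Gamma = fun s : ℝ => ((Complex.Gamma (s : ℂ))⁻¹)⁻¹.re := by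
    funext s
    rw [inv_inv, Complex.Gamma_ofReal, Complex.ofReal_re]
  rw [h]
  have hc : Continuous fun s : ℂ => (Complex.Gamma s)⁻¹ :=
    Complex.differentiable_one_div_Gamma.continuous
  exact Complex.measurable_re.comp ((hc.comp Complex.continuous_ofReal).measurable.inv)

/-- Joint measurability in the parameters matters because they are random along a run. -/
theorem measurable_betaPDF_uncurry :
    Measurable fun p : (ℝ × ℝ) × ℝ => betaPDF p.1.1 p.1.2 p.2 := by
  have hg := measurable_gamma
  refine ENNReal.measurable_ofReal.comp ?_
  unfold betaPDFReal ProbabilityTheory.beta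
  refine Measurable.ite ?_ ?_ measurable_const
  · exact (measurableSet_lt measurable_const measurable_snd).inter
      (measurableSet_lt measurable_snd measurable_const)
  · have h1 := hg.comp (measurable_fst.comp measurable_fst : Measurable fun p : (ℝ × ℝ) × ℝ => p.1.1)
    have h2 := hg.comp (measurable_snd.comp measurable_fst : Measurable fun p : (ℝ × ℝ) × ℝ => p.1.2)
    have h3 := hg.comp ((measurable_fst.comp measurable_fst).add (measurable_snd.comp measurable_fst)
      : Measurable fun p : (ℝ × ℝ) × ℝ => p.1.1 + p.1.2)
    refine Measurable.mul (Measurable.mul (measurable_const.div ((h1.mul h2).div h3)) ?_) ?_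
    · exact measurable_snd.pow ((measurable_fst.comp measurable_fst).sub_const 1)
    · exact (measurable_const.sub measurable_snd).pow
        ((measurable_snd.comp measurable_fst).sub_const 1)

theorem measurable_betaPDF (a b : ℝ) : Measurable (betaPDF a b) :=
  ENNReal.measurable_ofReal.comp (measurable_betaPDFReal a b)

theorem betaMeasure_compl_Icc (a b : ℝ) : betaMeasure a b (Set.Icc 0 1)ᶜ = 0 := by
  rw [betaMeasure, withDensity_apply _ measurableSet_Icc.compl]
  refine setLIntegral_eq_zero measurableSet_Icc.compl fun x hx => ?_
  rcases le_or_gt x 0 with h | h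
  · exact betaPDF_eq_zero_of_nonpos h
  · exact betaPDF_eq_zero_of_one_le (not_lt.1 fun h1 => hx ⟨h.le, h1.le⟩)

/-- Multiplying the Beta density by `x` raises the first parameter by one. -/
theorem mul_betaPDFReal {a b : ℝ} (ha : 0 < a) (hb : 0 < b) (x : ℝ) :
    x * betaPDFReal a b x = a / (a + b) * betaPDFReal (a + 1) b x := by
  unfold betaPDFReal
  split_ifs with h
  · have hG : ProbabilityTheory.beta (a + 1) b = a / (a + b) * ProbabilityTheory.beta a b := by
      unfold ProbabilityTheory.beta
      rw [show a + 1 + b = (a + b) + 1 by ring, Real.Gamma_add_one ha.ne',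
        Real.Gamma_add_one (by positivity)]
      have := (Real.Gamma_pos_of_pos (add_pos ha hb)).ne'
      field_simp
    have hB := (beta_pos ha hb).ne'
    rw [hG, show a + 1 - 1 = (a - 1) + 1 by ring, Real.rpow_add h.1, Real.rpow_one]
    field_simp
  · simp

theorem integrable_betaPDFReal {a b : ℝ} (ha : 0 < a) (hb : 0 < b) :
    Integrable (betaPDFReal a b) ∧ ∫ x, betaPDFReal a b x = 1 := by
  have h0 : ∀ x, 0 ≤ betaPDFReal a b x := fun x => by
    by_cases h : 0 < x ∧ x < 1
    · exact (betaPDFReal_pos h.1 h.2 ha hb).le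
    · simp [betaPDFReal, h]
  have h1 : ∫⁻ x, ENNReal.ofReal (betaPDFReal a b x) = 1 := lintegral_betaPDF_eq_one ha hb
  have hm := measurable_betaPDFReal a b
  refine ⟨⟨hm.aestronglyMeasurable, ?_⟩, ?_⟩
  · rw [hasFiniteIntegral_iff_ofReal (Eventually.of_forall h0), h1]
    exact ENNReal.one_lt_top
  · rw [integral_eq_lintegral_of_nonneg_ae (Eventually.of_forall h0) hm.aestronglyMeasurable, h1]
    simp

/-- The mean absolute deviation of a Beta law is at most `1 / √(a + b)`. -/
theorem lintegral_abs_sub_betaMeasure_le {a b : ℝ} (ha : 0 < a) (hb : 0 < b) :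
    ∫⁻ x, ENNReal.ofReal |x - a / (a + b)| ∂betaMeasure a b ≤
      ENNReal.ofReal (1 / Real.sqrt (a + b)) := by
  set n := a + b with hn
  have hn0 : 0 < n := add_pos ha hb
  set s := Real.sqrt n with hs
  have hs0 : 0 < s := Real.sqrt_pos.2 hn0
  have hss : s * s = n := Real.mul_self_sqrt hn0.le
  obtain ⟨i0, e0⟩ := integrable_betaPDFReal ha hb
  obtain ⟨i1, e1⟩ := integrable_betaPDFReal (by linarith : 0 < a + 1) hb
  obtain ⟨i2, e2⟩ := integrable_betaPDFReal (by linarith : 0 < a + 1 + 1) hb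
  set m := a / n with hm
  -- Majorant from `|y| ≤ 1 / (2 s) + s y² / 2` with `y = x - m`. The moments are written through
  -- Beta densities with raised parameters, so its integral follows from their normalization.
  let g : ℝ → ℝ := fun x => (1 / (2 * s)) * betaPDFReal a b x +
    s / 2 * (m * ((a + 1) / (a + 1 + b)) * betaPDFReal (a + 1 + 1) b x -
      2 * m * (m * betaPDFReal (a + 1) b x) + m ^ 2 * betaPDFReal a b x)
  have hpos : ∀ x, 0 ≤ betaPDFReal a b x := fun x => by
    by_cases h : 0 < x ∧ x < 1
    · exact (betaPDFReal_pos h.1 h.2 ha hb).le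
    · simp [betaPDFReal, h]
  have hg : ∀ x, g x = (1 / (2 * s) + s / 2 * (x - m) ^ 2) * betaPDFReal a b x := fun x => by
    have h1 := mul_betaPDFReal ha hb x
    have h2 := mul_betaPDFReal (by linarith : 0 < a + 1) hb x
    have h3 : m * ((a + 1) / (a + 1 + b)) * betaPDFReal (a + 1 + 1) b x =
        x * (x * betaPDFReal a b x) := by
      rw [h1, mul_assoc, ← h2]; ring
    simp only [g]
    rw [h3, hm, ← h1]; ring
  have hgi : Integrable g := by
    simp only [g]
    fun_prop
  have hgint : ∫ x, g x = 1 / (2 * s) + s / 2 * (m * ((a + 1) / (a + 1 + b)) - 2 * m * m + m ^ 2) := by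
    simp only [g]
    rw [integral_add (by fun_prop) (by fun_prop), integral_const_mul, integral_const_mul,
      integral_add (by fun_prop) (by fun_prop), integral_sub (by fun_prop) (by fun_prop),
      integral_const_mul, integral_const_mul, integral_const_mul, integral_const_mul, e0, e1, e2]
    ring
  have hle : ∫ x, g x ≤ 1 / s := by
    rw [hgint]
    have hv : m * ((a + 1) / (a + 1 + b)) - 2 * m * m + m ^ 2 ≤ 1 / n := by
      -- This is the variance of the Beta law.
      have : m * ((a + 1) / (a + 1 + b)) - 2 * m * m + m ^ 2 = a * b / (n * n) / (n + 1) := by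
        rw [hm, show a + 1 + b = n + 1 by rw [hn]; ring]
        have hb' : b = n - a := by rw [hn]; ring
        rw [hb']
        field_simp
        ring
      rw [this, div_div, div_le_div_iff₀ (by positivity) hn0]
      have hab : a * b ≤ n * n := by rw [hn]; nlinarith
      have : a * b * n ≤ n * n * n := mul_le_mul_of_nonneg_right hab hn0.le
      nlinarith [mul_pos hn0 hn0]
    have h2 : s / 2 * (m * ((a + 1) / (a + 1 + b)) - 2 * m * m + m ^ 2) ≤ s / 2 * (1 / n) :=
      mul_le_mul_of_nonneg_left hv (by positivity)
    have h3 : s / 2 * (1 / n) = 1 / (2 * s) := by rw [← hss]; field_simp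
    have h4 : 1 / (2 * s) + 1 / (2 * s) = 1 / s := by field_simp; norm_num
    linarith
  rw [betaMeasure, lintegral_withDensity_eq_lintegral_mul _
    (measurable_betaPDF a b) (by fun_prop)]
  calc _ ≤ ∫⁻ x, ENNReal.ofReal (g x) := by
        refine lintegral_mono fun x => ?_
        simp only [Pi.mul_apply, betaPDF]
        rw [← ENNReal.ofReal_mul (hpos x)]
        refine ENNReal.ofReal_le_ofReal ?_
        rw [hg, mul_comm]
        refine mul_le_mul_of_nonneg_right ?_ (hpos x)
        have h : 1 / (2 * s) + s / 2 * (x - m) ^ 2 - |x - m| = (1 - s * |x - m|) ^ 2 / (2 * s) := by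
          rw [← sq_abs (x - m)]
          field_simp
          ring
        have : 0 ≤ (1 - s * |x - m|) ^ 2 / (2 * s) := by positivity
        linarith
    _ = ENNReal.ofReal (∫ x, g x) := by
        rw [ofReal_integral_eq_lintegral_ofReal hgi]
        refine Eventually.of_forall fun x => ?_
        simp only [Pi.zero_apply, hg]
        have := hpos x
        positivity
    _ ≤ _ := ENNReal.ofReal_le_ofReal hle

/-! ### Conditional Beta laws with random parameters. -/

/-- Integration of a function of the conditioned variable and of known quantities against a
conditional Beta law. -/
theorem HasCondBetaLaw.lintegral_comp {Ω : Type*} {m mΩ : MeasurableSpace Ω} {μ : Measure Ω}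
    [IsFiniteMeasure μ] (hm : m ≤ mΩ) {X a b : Ω → ℝ} {W : Ω → ℝ≥0∞}
    (hX : Measurable X) (ha : Measurable[m] a) (hb : Measurable[m] b) (hW : Measurable[m] W)
    (h : HasCondBetaLaw μ m X a b) {f : (ℝ≥0∞ × ℝ × ℝ) × ℝ → ℝ≥0∞} (hf : Measurable f) :
    ∫⁻ ω, f ((W ω, a ω, b ω), X ω) ∂μ =
      ∫⁻ ω, ∫⁻ x, f ((W ω, a ω, b ω), x) ∂betaMeasure (a ω) (b ω) ∂μ := by
  let Y : Ω → ℝ≥0∞ × ℝ × ℝ := fun ω => (W ω, a ω, b ω)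
  have hYm : Measurable[m] Y := hW.prodMk (ha.prodMk hb)
  have hY : Measurable Y := hYm.mono hm le_rfl
  let d : (ℝ≥0∞ × ℝ × ℝ) × ℝ → ℝ≥0∞ := fun p => betaPDF p.1.2.1 p.1.2.2 p.2
  have hd : Measurable d := measurable_betaPDF_uncurry.comp
    ((measurable_snd.comp measurable_fst).prodMk measurable_snd)
  -- The joint law of the known data and `X` has the Beta density relative to the product measure.
  -- On rectangles this is the hypothesis with `A = Y ⁻¹' s`, and rectangles determine the law.
  have key : μ.map (fun ω => (Y ω, X ω)) = ((μ.map Y).prod volume).withDensity d := by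
    refine Measure.ext_prod fun {s t} hs ht => ?_
    rw [Measure.map_apply (hY.prodMk hX) (hs.prod ht), withDensity_apply _ (hs.prod ht),
      ← Measure.prod_restrict, lintegral_prod _ hd.aemeasurable,
      setLIntegral_map hs hd.lintegral_prod_right' hY]
    have := h (Y ⁻¹' s) (hYm hs) t ht
    rw [show (fun ω => (Y ω, X ω)) ⁻¹' s ×ˢ t = Y ⁻¹' s ∩ X ⁻¹' t from rfl, this]
    refine lintegral_congr fun ω => ?_
    rw [betaMeasure, withDensity_apply _ ht]
  calc _ = ∫⁻ p, f p ∂(μ.map (fun ω => (Y ω, X ω))) := (lintegral_map hf (hY.prodMk hX)).symm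
    _ = _ := by
      rw [key, lintegral_withDensity_eq_lintegral_mul _ hd hf,
        lintegral_prod _ (hd.mul hf).aemeasurable,
        lintegral_map (hd.mul hf).lintegral_prod_right' hY]
      refine lintegral_congr fun ω => ?_
      rw [betaMeasure, lintegral_withDensity_eq_lintegral_mul _
        (measurable_betaPDF _ _)
        (show Measurable fun x => f ((W ω, a ω, b ω), x) from hf.comp measurable_prodMk_left)]
      rfl

theorem HasCondBetaLaw.ae_mem_Icc {Ω : Type*} {m mΩ : MeasurableSpace Ω} {μ : Measure Ω}
    {X a b : Ω → ℝ} (h : HasCondBetaLaw μ m X a b) : ∀ᵐ ω ∂μ, X ω ∈ Set.Icc (0 : ℝ) 1 := by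
  have := h Set.univ MeasurableSet.univ (Set.Icc (0 : ℝ) 1)ᶜ measurableSet_Icc.compl
  simp only [betaMeasure_compl_Icc, lintegral_zero, Set.univ_inter] at this
  exact this

/-- The weight `W` is known when conditioning, so it factors out. It serves with `W = 1` for
expectations, and with the exponential of past deviations for the exponential moment. -/
theorem HasCondBetaLaw.lintegral_mul_abs_sub_le {Ω : Type*} {m mΩ : MeasurableSpace Ω}
    {μ : Measure Ω} [IsFiniteMeasure μ] (hm : m ≤ mΩ) {X a b : Ω → ℝ} {W : Ω → ℝ≥0∞}
    (hX : Measurable X) (ha : Measurable[m] a) (hb : Measurable[m] b) (hW : Measurable[m] W)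
    (h : HasCondBetaLaw μ m X a b) (ha0 : ∀ ω, 0 < a ω) (hb0 : ∀ ω, 0 < b ω)
    {u : ℝ} (hu : ∀ ω, 1 / Real.sqrt (a ω + b ω) ≤ u) :
    ∫⁻ ω, W ω * ENNReal.ofReal |X ω - a ω / (a ω + b ω)| ∂μ ≤
      ENNReal.ofReal u * ∫⁻ ω, W ω ∂μ := by
  have hf : Measurable fun p : (ℝ≥0∞ × ℝ × ℝ) × ℝ =>
      p.1.1 * ENNReal.ofReal |p.2 - p.1.2.1 / (p.1.2.1 + p.1.2.2)| := by
    fun_prop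
  have hWm : Measurable W := hW.mono hm le_rfl
  rw [h.lintegral_comp hm hX ha hb hW hf, ← lintegral_const_mul _ hWm]
  refine lintegral_mono fun ω => ?_
  dsimp only
  rw [lintegral_const_mul _ (by fun_prop), mul_comm]
  gcongr
  exact (lintegral_abs_sub_betaMeasure_le (ha0 ω) (hb0 ω)).trans (ENNReal.ofReal_le_ofReal (hu ω))

/-! ### Exponential moments and almost sure growth of accumulated deviations. -/

theorem exp_le_one_add_two_mul {u : ℝ} (h0 : 0 ≤ u) (h1 : u ≤ 1) : Real.exp u ≤ 1 + 2 * u := by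
  have h := (abs_le.1 (Real.abs_exp_sub_one_sub_id_le (abs_le.2 ⟨by linarith, h1⟩))).2
  nlinarith

theorem abs_sub_le_one {x y : ℝ} (hx : x ∈ Set.Icc (0 : ℝ) 1) (hy : y ∈ Set.Icc (0 : ℝ) 1) :
    |x - y| ≤ 1 :=
  abs_le.2 ⟨by linarith [hx.1, hy.2], by linarith [hx.2, hy.1]⟩

theorem div_add_mem_Icc {a b : ℝ} (ha : 0 < a) (hb : 0 < b) : a / (a + b) ∈ Set.Icc (0 : ℝ) 1 :=
  ⟨by positivity, (div_le_one (by positivity)).2 (by linarith)⟩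

section Deviation

variable {Ω : Type*} {mΩ : MeasurableSpace Ω} {μ : Measure Ω} [IsProbabilityMeasure μ]
  {ℱ : Filtration ℕ mΩ} {X a b : ℕ → Ω → ℝ} {u : ℕ → ℝ}

/-- The exponential moment of the accumulated deviation from the conditional means. -/
theorem lintegral_exp_sum_abs_sub_le
    (hX : ∀ t, Measurable[ℱ (t + 1)] (X t)) (ha : ∀ t, Measurable[ℱ t] (a t))
    (hb : ∀ t, Measurable[ℱ t] (b t)) (ha0 : ∀ t ω, 0 < a t ω) (hb0 : ∀ t ω, 0 < b t ω)
    (h : ∀ t, HasCondBetaLaw μ (ℱ t) (X t) (a t) (b t))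
    (hu : ∀ t ω, 1 / Real.sqrt (a t ω + b t ω) ≤ u t) (T : ℕ) :
    ∫⁻ ω, ENNReal.ofReal
        (Real.exp (∑ t ∈ Finset.range T, |X t ω - a t ω / (a t ω + b t ω)|)) ∂μ ≤
      ENNReal.ofReal (Real.exp (2 * ∑ t ∈ Finset.range T, u t)) := by
  have hu0 : ∀ t, 0 ≤ u t := fun t => by
    obtain ⟨ω⟩ := μ.nonempty_of_neZero
    exact le_trans (by positivity) (hu t ω)
  induction T with
  | zero => simp
  | succ T ih =>
    set W : Ω → ℝ≥0∞ := fun ω => ENNReal.ofReal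
      (Real.exp (∑ t ∈ Finset.range T, |X t ω - a t ω / (a t ω + b t ω)|)) with hWdef
    have hW : Measurable[ℱ T] W := by
      refine ENNReal.measurable_ofReal.comp (Real.measurable_exp.comp ?_)
      refine Finset.measurable_fun_sum _ fun t ht => ?_
      have ht : t < T := Finset.mem_range.1 ht
      have h1 := (hX t).mono (ℱ.mono (Nat.succ_le_of_lt ht)) le_rfl
      have h2 := (ha t).mono (ℱ.mono ht.le) le_rfl
      have h3 := (hb t).mono (ℱ.mono ht.le) le_rfl
      have h4 := h1.sub (h2.div (h2.add h3))
      exact continuous_abs.measurable.comp h4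
    have hWm : Measurable W := hW.mono (ℱ.le T) le_rfl
    have hdev := (h T).lintegral_mul_abs_sub_le (ℱ.le T) ((hX T).mono (ℱ.le _) le_rfl) (ha T) (hb T)
      hW (ha0 T) (hb0 T) (hu T)
    -- The new deviation is at most 1, so its exponential is at most one plus twice itself.
    -- Conditionally, the round costs a factor `1 + 2 u T ≤ exp (2 u T)`.
    calc _ ≤ ∫⁻ ω, (W ω + 2 * (W ω * ENNReal.ofReal |X T ω - a T ω / (a T ω + b T ω)|)) ∂μ := by
          refine lintegral_mono_ae ?_
          filter_upwards [(h T).ae_mem_Icc] with ω hω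
          rw [Finset.sum_range_succ, Real.exp_add, ENNReal.ofReal_mul (Real.exp_pos _).le]
          have h1 := exp_le_one_add_two_mul (abs_nonneg _)
            (abs_sub_le_one hω (div_add_mem_Icc (ha0 T ω) (hb0 T ω)))
          calc _ ≤ W ω * ENNReal.ofReal (1 + 2 * |X T ω - a T ω / (a T ω + b T ω)|) := by
                gcongr
            _ = _ := by
              rw [ENNReal.ofReal_add zero_le_one (by positivity), ENNReal.ofReal_mul zero_le_two,
                ENNReal.ofReal_one, ENNReal.ofReal_ofNat]
              ring
      _ = ∫⁻ ω, W ω ∂μ +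
          2 * ∫⁻ ω, W ω * ENNReal.ofReal |X T ω - a T ω / (a T ω + b T ω)| ∂μ := by
          rw [lintegral_add_left hWm, lintegral_const_mul' _ _ (by norm_num)]
      _ ≤ ∫⁻ ω, W ω ∂μ + 2 * (ENNReal.ofReal (u T) * ∫⁻ ω, W ω ∂μ) := by gcongr
      _ = ENNReal.ofReal (1 + 2 * u T) * ∫⁻ ω, W ω ∂μ := by
          rw [ENNReal.ofReal_add zero_le_one (by linarith [hu0 T]), ENNReal.ofReal_mul zero_le_two,
                ENNReal.ofReal_one, ENNReal.ofReal_ofNat]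
          ring
      _ ≤ ENNReal.ofReal (Real.exp (2 * u T)) *
          ENNReal.ofReal (Real.exp (2 * ∑ t ∈ Finset.range T, u t)) := by
          gcongr
          linarith [Real.add_one_le_exp (2 * u T)]
      _ = _ := by
          rw [← ENNReal.ofReal_mul (Real.exp_pos _).le, ← Real.exp_add, Finset.sum_range_succ]
          ring_nf

/-- Almost surely the accumulated deviation from the conditional means grows at most linearly, with
four times the rate `c` that bounds the accumulated conditional standard deviations. -/
theorem ae_eventually_sum_abs_sub_le
    (hX : ∀ t, Measurable[ℱ (t + 1)] (X t)) (ha : ∀ t, Measurable[ℱ t] (a t))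
    (hb : ∀ t, Measurable[ℱ t] (b t)) (ha0 : ∀ t ω, 0 < a t ω) (hb0 : ∀ t ω, 0 < b t ω)
    (h : ∀ t, HasCondBetaLaw μ (ℱ t) (X t) (a t) (b t))
    (hu : ∀ t ω, 1 / Real.sqrt (a t ω + b t ω) ≤ u t) {c L : ℝ} (hc : 0 < c)
    (hsum : ∀ T : ℕ, ∑ t ∈ Finset.range T, u t ≤ c * T + L * Real.sqrt T) :
    ∀ᵐ ω ∂μ, ∀ᶠ T : ℕ in atTop,
      ∑ t ∈ Finset.range T, |X t ω - a t ω / (a t ω + b t ω)| ≤ 4 * c * T := by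
  let A : ℕ → Set Ω := fun T =>
    {ω | 4 * c * T < ∑ t ∈ Finset.range T, |X t ω - a t ω / (a t ω + b t ω)|}
  have hA : ∀ T, μ (A T) ≤ ENNReal.ofReal (Real.exp (L ^ 2 / c) * Real.exp (-c) ^ T) := fun T => by
    have hm : Measurable fun ω => ENNReal.ofReal
        (Real.exp (∑ t ∈ Finset.range T, |X t ω - a t ω / (a t ω + b t ω)|)) := by
      refine ENNReal.measurable_ofReal.comp (Real.measurable_exp.comp ?_)
      refine Finset.measurable_fun_sum _ fun t _ => ?_
      have h1 := (hX t).mono (ℱ.le _) le_rfl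
      have h2 := (ha t).mono (ℱ.le _) le_rfl
      have h3 := (hb t).mono (ℱ.le _) le_rfl
      exact continuous_abs.measurable.comp (h1.sub (h2.div (h2.add h3)))
    have h1 := (mul_meas_ge_le_lintegral hm (ENNReal.ofReal (Real.exp (4 * c * T)))).trans
      (lintegral_exp_sum_abs_sub_le hX ha hb ha0 hb0 h hu T)
    have h2 : ENNReal.ofReal (Real.exp (4 * c * T)) * μ (A T) ≤
        ENNReal.ofReal (Real.exp (2 * ∑ t ∈ Finset.range T, u t)) := by
      refine le_trans ?_ h1
      gcongr
      exact fun ω hω => ENNReal.ofReal_le_ofReal (Real.exp_le_exp.2 (le_of_lt hω))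
    have h3 : μ (A T) = ENNReal.ofReal (Real.exp (-(4 * c * T))) *
        (ENNReal.ofReal (Real.exp (4 * c * T)) * μ (A T)) := by
      rw [← mul_assoc, ← ENNReal.ofReal_mul (Real.exp_pos _).le, ← Real.exp_add]
      simp
    rw [h3]
    refine (mul_le_mul_right h2 _).trans ?_
    rw [← ENNReal.ofReal_mul (Real.exp_pos _).le, ← Real.exp_add, ← Real.exp_nat_mul,
      ← Real.exp_add]
    refine ENNReal.ofReal_le_ofReal (Real.exp_le_exp.2 ?_)
    -- Markov leaves the exponent `-4cT + 2(cT + L√T)`. Completing the square, `2L√T ≤ L²/c + cT`,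
    -- so it is at most `L²/c - cT`.
    have hs := Real.sq_sqrt (Nat.cast_nonneg (α := ℝ) T)
    have h4 : L ^ 2 / c - 2 * L * Real.sqrt T + c * T = (L - c * Real.sqrt T) ^ 2 / c := by
      field_simp
      rw [← hs, Real.sqrt_sq (Real.sqrt_nonneg _)]
      ring
    have h5 : 0 ≤ (L - c * Real.sqrt T) ^ 2 / c := by positivity
    linarith [hsum T]
  -- The tails are geometric with ratio `exp (-c) < 1`, as Borel–Cantelli requires.
  have hfin : ∑' T, μ (A T) ≠ ∞ := by
    refine ne_top_of_le_ne_top ?_ (ENNReal.tsum_le_tsum hA)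
    refine Summable.tsum_ofReal_ne_top (Summable.mul_left _ ?_)
    exact summable_geometric_of_lt_one (Real.exp_pos _).le (Real.exp_lt_one_iff.mpr (by linarith))
  filter_upwards [ae_eventually_notMem hfin] with ω hω
  exact hω.mono fun T hT => not_lt.1 hT

end Deviation

/-! ### Elementary estimates for sums and for the discounted weight. -/

theorem sum_one_div_sqrt_le (T : ℕ) :
    ∑ t ∈ Finset.range T, 1 / Real.sqrt ((t : ℝ) + 1) ≤ 2 * Real.sqrt T := by
  induction T with
  | zero => simp
  | succ T ih =>
    rw [Finset.sum_range_succ, Nat.cast_succ]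
    have h0 : (0 : ℝ) ≤ T := Nat.cast_nonneg T
    have h1 := Real.sq_sqrt h0
    have h2 := Real.sq_sqrt (by linarith : (0 : ℝ) ≤ T + 1)
    have h3 : 0 < Real.sqrt ((T : ℝ) + 1) := Real.sqrt_pos.2 (by linarith)
    have h4 : 1 / Real.sqrt ((T : ℝ) + 1) ≤
        2 * Real.sqrt ((T : ℝ) + 1) - 2 * Real.sqrt T := by
      rw [div_le_iff₀ h3]
      nlinarith [sq_nonneg (Real.sqrt ((T : ℝ) + 1) - Real.sqrt T)]
    linarith

theorem sqrt_le_two_mul_sqrt_mul_log {T : ℕ} (hT : 2 ≤ T) :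
    Real.sqrt T ≤ 2 * Real.sqrt (T * Real.log T) := by
  have hT' : (2 : ℝ) ≤ T := by exact_mod_cast hT
  have h1 : (1 / 4 : ℝ) ≤ Real.log T := by
    linarith [Real.log_two_gt_d9, Real.log_le_log zero_lt_two hT']
  rw [show (2 : ℝ) = Real.sqrt (2 ^ 2) by rw [Real.sqrt_sq zero_le_two],
    ← Real.sqrt_mul (by norm_num)]
  refine Real.sqrt_le_sqrt ?_
  nlinarith

/-- A geometric sum with ratio `1 - 1 / (2 M)` grows linearly up to time `M`. -/
theorem half_min_le_geom_sum {M : ℕ} (hM : 1 ≤ M) (n : ℕ) :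
    (min n M : ℕ) / (2 : ℝ) ≤ ∑ i ∈ Finset.range n, (1 - 1 / (2 * (M : ℝ))) ^ i := by
  have hM' : (1 : ℝ) ≤ M := by exact_mod_cast hM
  have hM0 : (0 : ℝ) < M := by linarith
  have hq : 1 / (2 * (M : ℝ)) ≤ 1 := by rw [div_le_one (by positivity)]; linarith
  calc ((min n M : ℕ) : ℝ) / 2 = ∑ _i ∈ Finset.range (min n M), (1 / 2 : ℝ) := by
        rw [Finset.sum_const, Finset.card_range, nsmul_eq_mul]; ring
    _ ≤ ∑ i ∈ Finset.range (min n M), (1 - 1 / (2 * (M : ℝ))) ^ i := by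
        refine Finset.sum_le_sum fun i hi => ?_
        have hi' : (i : ℝ) ≤ M := by
          exact_mod_cast ((Finset.mem_range.1 hi).trans_le (min_le_right _ _)).le
        -- By Bernoulli's inequality each term with `i ≤ M` is at least `1 - i / (2 M) ≥ 1 / 2`.
        have h := one_add_mul_le_pow (a := -(1 / (2 * (M : ℝ)))) (by linarith) i
        have h2 : (i : ℝ) * (1 / (2 * (M : ℝ))) ≤ 1 / 2 := by
          rw [mul_one_div, div_le_div_iff₀ (by positivity) (by norm_num)]
          linarith
        rw [sub_eq_add_neg]
        linarith
    _ ≤ _ := by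
        refine Finset.sum_le_sum_of_subset_of_nonneg
          (Finset.range_subset_range.2 (min_le_left _ _)) fun i _ _ => ?_
        exact pow_nonneg (by linarith) i

/-- Two regimes: up to time `M` the weight grows linearly, which gives the `1 / √(t + 1)` term;
afterwards it stays at least of order `M`, which gives the `1 / √M` term. -/
theorem one_div_sqrt_le_of_geom_sum_le {M : ℕ} (hM : 1 ≤ M) {c N : ℝ} (hc : 0 < c) (t : ℕ)
    (h : c * ∑ i ∈ Finset.range (t + 1), (1 - 1 / (2 * (M : ℝ))) ^ i ≤ N) :
    1 / Real.sqrt N ≤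
      Real.sqrt (2 / c) * (1 / Real.sqrt ((t : ℝ) + 1) + 1 / Real.sqrt M) := by
  have hM0 : (0 : ℝ) < M := by exact_mod_cast hM
  have key : ∀ x : ℝ, 0 < x → c * (x / 2) ≤ N →
      1 / Real.sqrt N ≤ Real.sqrt (2 / c) * (1 / Real.sqrt x) := fun x hx hN => by
    rw [← Real.sqrt_one, ← Real.sqrt_div zero_le_one, ← Real.sqrt_div zero_le_one,
      ← Real.sqrt_mul (by positivity)]
    refine Real.sqrt_le_sqrt ?_
    rw [show 2 / c * (1 / x) = 1 / (c * (x / 2)) by field_simp]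
    exact one_div_le_one_div_of_le (by positivity) hN
  have hmin := mul_le_mul_of_nonneg_left (half_min_le_geom_sum hM (t + 1)) hc.le
  rw [mul_add]
  rcases le_total (t + 1) M with h1 | h1
  · rw [min_eq_left h1, Nat.cast_succ] at hmin
    exact (key _ (by positivity) (hmin.trans h)).trans (le_add_of_nonneg_right (by positivity))
  · rw [min_eq_right h1] at hmin
    exact (key _ hM0 (hmin.trans h)).trans (le_add_of_nonneg_left (by positivity))

/-! ### Bounds for the Beta parameters and the reweighting factors, uniform in the feedback. -/

namespace System

variable {E C : Type*} [Fintype E] [DecidableEq E] [Fintype C] [DecidableEq C]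
  (sys : System E C) {par : Params} {r : ℕ → sys.Team → ℝ}

instance : Nonempty sys.Team := sys.teams_nonempty.to_subtype

theorem exists_pos_le (f : sys.Team → ℝ) (hf : ∀ S, 0 < f S) : ∃ c, 0 < c ∧ ∀ S, c ≤ f S := by
  obtain ⟨S, hS⟩ := Finite.exists_min f
  exact ⟨f S, hf S, hS⟩

theorem overlap_mem (S : sys.Team) (t : ℕ) : sys.overlap S t ∈ Set.Icc (0 : ℝ) 1 := by
  refine ⟨by unfold overlap; positivity, div_le_one_of_le₀ ?_ (by positivity)⟩
  exact_mod_cast Finset.card_le_card (Finset.inter_subset_left.trans Finset.subset_union_left)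

theorem km_mem (S : sys.Team) (t : ℕ) : sys.km S t ∈ Set.Icc (0 : ℝ) 1 := by
  have h1 := sys.overlap_mem S t
  have h2 : sys.synergy S ∈ Set.Icc (0 : ℝ) 1 := sys.synergy_mem S.1 S.2
  exact ⟨mul_nonneg h1.1 h2.1, mul_le_one₀ h1.2 h2.1 h2.2⟩

theorem alpha_pos (hg : 0 < par.gam) (hr : ∀ t S, r t S ∈ Set.Icc (0 : ℝ) 1) (t : ℕ)
    (S : sys.Team) : 0 < sys.alpha par r t S := by
  induction t with
  | zero => exact sys.alpha0_pos S
  | succ t ih =>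
    have h1 := (hr t S).1
    have h2 := mul_nonneg sys.delta_nonneg (sys.km_mem S t).1
    have h3 := mul_pos (Real.rpow_pos_of_pos hg (sys.dt t)) ih
    rw [alpha]
    linarith

theorem beta_pos (hg : 0 < par.gam) (hr : ∀ t S, r t S ∈ Set.Icc (0 : ℝ) 1) (t : ℕ)
    (S : sys.Team) : 0 < sys.beta par r t S := by
  induction t with
  | zero => exact sys.beta0_pos S
  | succ t ih =>
    have h1 := (hr t S).2
    have h2 := mul_nonneg sys.delta_nonneg (sub_nonneg.2 (sys.km_mem S t).2)
    have h3 := mul_pos (Real.rpow_pos_of_pos hg (sys.dt t)) ih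
    rw [beta]
    linarith

/-- The total weight of the Beta law grows at least like a geometric sum. -/
theorem geom_sum_le_alpha_add_beta {c q : ℝ} (hc : 0 < c) (hc1 : c ≤ 1) (hq : 0 ≤ q)
    (hqg : ∀ t, q ≤ par.gam ^ sys.dt t) (S : sys.Team)
    (h0 : c ≤ sys.alpha0 S + sys.beta0 S) (t : ℕ) :
    c * ∑ i ∈ Finset.range (t + 1), q ^ i ≤ sys.alpha par r t S + sys.beta par r t S := by
  induction t with
  | zero => simpa [alpha, beta] using h0
  | succ t ih =>
    have hs : 0 ≤ c * ∑ i ∈ Finset.range (t + 1), q ^ i :=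
      mul_nonneg hc.le (Finset.sum_nonneg fun i _ => pow_nonneg hq i)
    have h1 : q * (c * ∑ i ∈ Finset.range (t + 1), q ^ i) ≤
        par.gam ^ sys.dt t * (sys.alpha par r t S + sys.beta par r t S) :=
      mul_le_mul (hqg t) ih hs (hq.trans (hqg t))
    have h2 : c * ∑ i ∈ Finset.range (t + 1 + 1), q ^ i =
        q * (c * ∑ i ∈ Finset.range (t + 1), q ^ i) + c := by
      rw [Finset.sum_range_succ' _ (t + 1), mul_add, pow_zero, mul_one, mul_left_comm,
        Finset.mul_sum _ _ q]
      simp_rw [pow_succ']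
    -- In the sum of the two updates the feedback and the matching index cancel: the increment is `1
    -- + δ ≥ 1 ≥ c`.
    rw [h2, alpha, beta]
    linarith [sys.delta_nonneg]

theorem histRate_mem (hr : ∀ t S, r t S ∈ Set.Icc (0 : ℝ) 1) (S : sys.Team) (t : ℕ) :
    sys.histRate r S t ∈ Set.Icc (0 : ℝ) 1 := by
  unfold histRate
  refine ⟨div_nonneg (Finset.sum_nonneg fun s _ => (hr s S).1) (Nat.cast_nonneg t),
    div_le_one_of_le₀ ?_ (Nat.cast_nonneg t)⟩
  simpa using Finset.sum_le_sum fun s (_ : s ∈ Finset.range t) => (hr s S).2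

/-- The knowledge distance is bounded. -/
theorem exists_abs_dist_le : ∃ B, 0 ≤ B ∧ ∀ r : ℕ → sys.Team → ℝ,
    (∀ t S, r t S ∈ Set.Icc (0 : ℝ) 1) → ∀ S t, |sys.dist r S t| ≤ B := by
  obtain ⟨d, hd⟩ := sys.difficulty_bdd
  have hd' : ∀ t, sys.difficulty t ≤ d := fun t => hd ⟨t, rfl⟩
  have hd0 : 0 ≤ d := (sys.difficulty_nonneg 0).trans (hd' 0)
  have hl0 : 0 ≤ Real.log (1 + d) := Real.log_nonneg (by linarith)
  -- The weights may be negative, hence the absolute values.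
  refine ⟨Real.log (1 + d) * (|sys.weight 0| + |sys.weight 1| * sys.depEdges.card +
    |sys.weight 2| + |sys.weight 3|), by positivity, fun r hr S t => ?_⟩
  have hlt : 0 ≤ Real.log (1 + sys.difficulty t) :=
    Real.log_nonneg (by linarith [sys.difficulty_nonneg t])
  unfold dist
  rw [abs_mul, abs_of_nonneg hlt]
  have hlog : Real.log (1 + sys.difficulty t) ≤ Real.log (1 + d) :=
    Real.log_le_log (by linarith [sys.difficulty_nonneg t]) (by linarith [hd' t])
  refine mul_le_mul hlog ?_ (abs_nonneg _) hl0
  have hmul : ∀ w x : ℝ, x ∈ Set.Icc (0 : ℝ) 1 → |w * (1 - x)| ≤ |w| := fun w x hx => by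
    rw [abs_mul, abs_of_nonneg (sub_nonneg.2 hx.2)]
    exact mul_le_of_le_one_right (abs_nonneg w) (by linarith [hx.1])
  have h1 := hmul (sys.weight 0) _ (sys.overlap_mem S t)
  have h2 := hmul (sys.weight 2) _ (sys.histRate_mem hr S t)
  have h3 := hmul (sys.weight 3) (sys.synergy S) (sys.synergy_mem S.1 S.2)
  have h4 : |sys.weight 1 * (((sys.depBetween S t).card : ℝ) / (Fintype.card E : ℝ))| ≤
      |sys.weight 1| * sys.depEdges.card := by
    rw [abs_mul]
    refine mul_le_mul_of_nonneg_left ?_ (abs_nonneg _)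
    rw [abs_of_nonneg (by positivity)]
    have hc : ((sys.depBetween S t).card : ℝ) ≤ sys.depEdges.card :=
      Nat.cast_le.2 (Finset.card_filter_le _ _)
    rcases Nat.eq_zero_or_pos (Fintype.card E) with h | h
    · simp [h]
    · exact (div_le_self (Nat.cast_nonneg _) (Nat.one_le_cast.2 h)).trans hc
  refine (abs_add_le _ _).trans (add_le_add ((abs_add_le _ _).trans (add_le_add
    ((abs_add_le _ _).trans (add_le_add h1 h4)) h2)) h3)

/-- A small synergy exponent makes the synergy factor close to one. -/
theorem exists_synergy_exponent {s : ℝ} (hs : 0 < s) : ∃ η : ℝ, 0 ≤ η ∧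
    ((∀ S, 0 < sys.synergy S) → 0 < η) ∧
    ∀ S, Real.exp (-s) ≤ sys.synergy S ^ η ∧ sys.synergy S ^ η ≤ 1 := by
  by_cases h : ∀ S, 0 < sys.synergy S
  · obtain ⟨m, hm, hmS⟩ := sys.exists_pos_le sys.synergy h
    have hsyn : ∀ S, sys.synergy S ≤ 1 := fun S => (sys.synergy_mem S.1 S.2).2
    have hm1 : Real.log m ≤ 0 :=
      Real.log_nonpos hm.le ((hmS (Classical.arbitrary _)).trans (hsyn _))
    have hden : 0 < 1 - Real.log m := by linarith
    -- The aim is `η log m ≥ -s`; the extra 1 keeps the denominator positive when `m = 1`.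
    refine ⟨s / (1 - Real.log m), by positivity, fun _ => by positivity, fun S => ⟨?_, ?_⟩⟩
    · refine le_trans ?_ (Real.rpow_le_rpow hm.le (hmS S) (by positivity))
      rw [Real.rpow_def_of_pos hm]
      refine Real.exp_le_exp.2 ?_
      rw [← sub_nonneg, show Real.log m * (s / (1 - Real.log m)) - -s = s / (1 - Real.log m) by
        field_simp; ring]
      positivity
    · exact Real.rpow_le_one (h S).le (hsyn S) (by positivity)
  -- Some team has zero synergy, so only `η = 0` with `0 ^ 0 = 1` keeps its factor away from zero.
  · refine ⟨0, le_rfl, fun h' => absurd h' h, fun S => ?_⟩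
    rw [Real.rpow_zero]
    exact ⟨Real.exp_le_one_iff.2 (by linarith), le_rfl⟩

/-- If the reweighting factors are close to one, comparing confidences is nearly comparing the
estimates. -/
theorem le_add_of_confidence_le {s : ℝ} (hg : 0 < par.gam) {S S' : sys.Team} {t : ℕ}
    (hS : |par.lam * sys.dist r S t| ≤ s) (hS' : |par.lam * sys.dist r S' t| ≤ s)
    (hsyn : Real.exp (-s) ≤ sys.synergy S ^ par.eta) (hsyn' : sys.synergy S' ^ par.eta ≤ 1)
    {x x' : ℝ} (hx : x ∈ Set.Icc (0 : ℝ) 1) (hx' : x' ∈ Set.Icc (0 : ℝ) 1)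
    (h : sys.confidence par r t S x ≤ sys.confidence par r t S' x') :
    x ≤ x' + (Real.exp (3 * s) - 1) := by
  unfold confidence at h
  have hgp := Real.rpow_pos_of_pos hg (sys.dt t)
  have hs0 : 0 ≤ s := (abs_nonneg _).trans hS
  have h1 : x * Real.exp (-s) * par.gam ^ sys.dt t * Real.exp (-s) ≤
      x * Real.exp (-par.lam * sys.dist r S t) * par.gam ^ sys.dt t * sys.synergy S ^ par.eta := by
    have := hx.1
    gcongr
    linarith [(abs_le.1 hS).2]
  have h2 : x' * Real.exp (-par.lam * sys.dist r S' t) * par.gam ^ sys.dt t *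
      sys.synergy S' ^ par.eta ≤ x' * Real.exp s * par.gam ^ sys.dt t * 1 := by
    have := hx'.1
    refine mul_le_mul ?_ hsyn' (Real.rpow_nonneg (sys.synergy_mem S'.1 S'.2).1 _) (by positivity)
    gcongr
    linarith [(abs_le.1 hS').1]
  have h3 := h1.trans (h.trans h2)
  have h4 : x * Real.exp (-s) * Real.exp (-s) ≤ x' * Real.exp s := by
    refine le_of_mul_le_mul_right ?_ hgp
    calc _ = x * Real.exp (-s) * par.gam ^ sys.dt t * Real.exp (-s) := by ring
      _ ≤ _ := h3
      _ = _ := by ring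
  -- The common `γ^Δt` has cancelled. Of the three factors `exp s`, two come from the distances and
  -- one from the synergy of `S`.
  have h5 : x ≤ x' * Real.exp (3 * s) := by
    have e1 : Real.exp (-s) * Real.exp (-s) * Real.exp (2 * s) = 1 := by
      rw [← Real.exp_add, ← Real.exp_add, ← Real.exp_zero]; ring_nf
    have e2 : Real.exp s * Real.exp (2 * s) = Real.exp (3 * s) := by
      rw [← Real.exp_add]; ring_nf
    calc x = x * Real.exp (-s) * Real.exp (-s) * Real.exp (2 * s) := by
          rw [mul_assoc x, mul_assoc x, e1, mul_one]
      _ ≤ x' * Real.exp s * Real.exp (2 * s) := by gcongr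
      _ = _ := by rw [mul_assoc, e2]
  have h6 : 1 ≤ Real.exp (3 * s) := Real.one_le_exp (by linarith)
  nlinarith [hx'.2]

/-- The decay factor can be chosen so that it is at least `q` in every round. -/
theorem exists_gam {q : ℝ} (hq0 : 0 < q) (hq1 : q < 1) :
    ∃ g : ℝ, 0 < g ∧ g < 1 ∧ ∀ t, q ≤ g ^ sys.dt t := by
  obtain ⟨D, hD⟩ := sys.dt_bdd
  have hD' : ∀ t, sys.dt t ≤ D := fun t => hD ⟨t, rfl⟩
  have hD0 : 0 < D := (sys.dt_pos 0).trans_le (hD' 0)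
  have hg0 := Real.rpow_pos_of_pos hq0 (1 / D)
  have hg1 := Real.rpow_lt_one hq0.le hq1 (show 0 < 1 / D by positivity)
  -- The longest time step decays most, so the decay over `D` is set to exactly `q`.
  refine ⟨q ^ (1 / D), hg0, hg1, fun t => ?_⟩
  calc q = (q ^ (1 / D)) ^ D := by
        rw [← Real.rpow_mul hq0.le, one_div_mul_cancel hD0.ne', Real.rpow_one]
    _ ≤ _ := Real.rpow_le_rpow_of_exponent_ge hg0 hg1.le (hD' t)

end System

/-! ### Regret along a run, in expectation and almost surely. -/

theorem integrable_abs_sub {Ω : Type*} {mΩ : MeasurableSpace Ω} {μ : Measure Ω} [IsFiniteMeasure μ]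
    {X Y : Ω → ℝ} (hX : Measurable X) (hY : Measurable Y) (hX1 : ∀ᵐ ω ∂μ, X ω ∈ Set.Icc (0 : ℝ) 1)
    (hY1 : ∀ᵐ ω ∂μ, Y ω ∈ Set.Icc (0 : ℝ) 1) : Integrable (fun ω => |X ω - Y ω|) μ := by
  refine Integrable.of_bound (hX.sub hY).abs.aestronglyMeasurable 1 ?_
  filter_upwards [hX1, hY1] with ω h1 h2
  rw [Real.norm_eq_abs, abs_abs]
  exact abs_sub_le_one h1 h2

theorem HasCondBetaLaw.integral_abs_sub_le {Ω : Type*} {m mΩ : MeasurableSpace Ω}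
    {μ : Measure Ω} [IsProbabilityMeasure μ] (hm : m ≤ mΩ) {X a b : Ω → ℝ}
    (hX : Measurable X) (ha : Measurable[m] a) (hb : Measurable[m] b)
    (h : HasCondBetaLaw μ m X a b) (ha0 : ∀ ω, 0 < a ω) (hb0 : ∀ ω, 0 < b ω)
    {u : ℝ} (hu : ∀ ω, 1 / Real.sqrt (a ω + b ω) ≤ u) :
    ∫ ω, |X ω - a ω / (a ω + b ω)| ∂μ ≤ u := by
  have hu0 : 0 ≤ u := by
    obtain ⟨ω⟩ := μ.nonempty_of_neZero
    exact le_trans (by positivity) (hu ω)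
  have hint := integrable_abs_sub (μ := μ) (Y := fun ω => a ω / (a ω + b ω)) hX ((ha.div (ha.add hb)).mono hm le_rfl) h.ae_mem_Icc
    (Eventually.of_forall fun ω => div_add_mem_Icc (ha0 ω) (hb0 ω))
  have key := h.lintegral_mul_abs_sub_le hm hX ha hb (W := fun _ => 1) measurable_const ha0 hb0 hu
  simp only [one_mul, lintegral_const, measure_univ, mul_one] at key
  rw [← ENNReal.ofReal_le_ofReal_iff hu0, ofReal_integral_eq_lintegral_ofReal hint
    (Eventually.of_forall fun ω => abs_nonneg _)]
  exact key

namespace Run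

variable {E C : Type*} [Fintype E] [DecidableEq E] [Fintype C] [DecidableEq C]
  {sys : System E C} {par : Params} {rule : Rule} {Ω : Type*} {mΩ : MeasurableSpace Ω}
  {μ : Measure Ω} (run : Run sys par rule μ)

/-- The first Beta parameter along the run. -/
noncomputable def alpha (t : ℕ) (S : sys.Team) (ω : Ω) : ℝ :=
  sys.alpha par (fun s => run.reward s ω) t S

/-- The second Beta parameter along the run. -/
noncomputable def beta (t : ℕ) (S : sys.Team) (ω : Ω) : ℝ :=
  sys.beta par (fun s => run.reward s ω) t S

/-- The mean of the Beta law along the run. -/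
noncomputable def mean (t : ℕ) (S : sys.Team) (ω : Ω) : ℝ :=
  run.alpha t S ω / (run.alpha t S ω + run.beta t S ω)

theorem measurable_alpha (t : ℕ) (S : sys.Team) : Measurable[run.history t] (run.alpha t S) := by
  induction t with
  | zero => exact measurable_const
  | succ t ih =>
    have h1 := ih.mono (run.history.mono t.le_succ) le_rfl
    exact ((h1.const_mul _).add (run.measurable_reward t S)).add_const _

theorem measurable_beta (t : ℕ) (S : sys.Team) : Measurable[run.history t] (run.beta t S) := by
  induction t with
  | zero => exact measurable_const
  | succ t ih =>
    have h1 := ih.mono (run.history.mono t.le_succ) le_rfl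
    exact ((h1.const_mul _).add ((run.measurable_reward t S).const_sub _)).add_const _

theorem measurable_mean (t : ℕ) (S : sys.Team) : Measurable (run.mean t S) :=
  ((run.measurable_alpha t S).div
    ((run.measurable_alpha t S).add (run.measurable_beta t S))).mono (run.history.le t) le_rfl

theorem alpha_pos (hg : 0 < par.gam) (t : ℕ) (S : sys.Team) (ω : Ω) : 0 < run.alpha t S ω :=
  sys.alpha_pos hg (fun t S => run.reward_mem t ω S) t S

theorem beta_pos (hg : 0 < par.gam) (t : ℕ) (S : sys.Team) (ω : Ω) : 0 < run.beta t S ω :=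
  sys.beta_pos hg (fun t S => run.reward_mem t ω S) t S

theorem mean_mem (hg : 0 < par.gam) (t : ℕ) (S : sys.Team) (ω : Ω) :
    run.mean t S ω ∈ Set.Icc (0 : ℝ) 1 :=
  div_add_mem_Icc (run.alpha_pos hg t S ω) (run.beta_pos hg t S ω)

/-- The estimates either have the conditional Beta law or are its mean. -/
theorem est_cases :
    (∀ t S, HasCondBetaLaw μ (run.history t) (fun ω => run.est t ω S) (run.alpha t S)
      (run.beta t S)) ∨ ∀ t S ω, run.est t ω S = run.mean t S ω := by
  cases rule with
  | draw => exact Or.inl run.est_law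
  | mean => exact Or.inr run.est_law

theorem measurable_est' (t : ℕ) (S : sys.Team) : Measurable fun ω => run.est t ω S :=
  (run.measurable_est t S).mono (run.history.le _) le_rfl

theorem ae_theta_mem : ∀ᵐ ω ∂μ, ∀ t S, run.theta t ω S ∈ Set.Icc (0 : ℝ) 1 := by
  simp only [ae_all_iff]
  exact fun t S => (run.theta_law t S).ae_mem_Icc

theorem ae_est_mem (hg : 0 < par.gam) :
    ∀ᵐ ω ∂μ, ∀ t S, run.est t ω S ∈ Set.Icc (0 : ℝ) 1 := by
  simp only [ae_all_iff]
  intro t S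
  rcases run.est_cases with h | h
  · exact (h t S).ae_mem_Icc
  · exact Eventually.of_forall fun ω => h t S ω ▸ run.mean_mem hg t S ω

theorem measurable_theta_comp {f : Ω → sys.Team} (hf : ∀ S, MeasurableSet {ω | f ω = S}) (t : ℕ) :
    Measurable fun ω => run.theta t ω (f ω) := by
  have h : (fun ω => run.theta t ω (f ω)) =
      fun ω => ∑ S, if f ω = S then run.theta t ω S else 0 := by
    funext ω
    simp
  rw [h]
  exact Finset.measurable_fun_sum _ fun S _ =>
    Measurable.ite (hf S) (run.measurable_theta t S) measurable_const

theorem integrable_regret [IsFiniteMeasure μ] {opt : ℕ → Ω → sys.Team}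
    (hopt : ∀ t S, MeasurableSet {ω | opt t ω = S}) (T : ℕ) : Integrable (run.regret opt T) μ := by
  refine integrable_finsetSum _ fun t _ => ?_
  refine Integrable.of_bound ((run.measurable_theta_comp (hopt t) t).sub
    (run.measurable_theta_comp (fun S => run.history.le _ _ (run.measurable_selected t S))
      t)).aestronglyMeasurable 1 ?_
  filter_upwards [run.ae_theta_mem] with ω h
  exact abs_sub_le_one (h t _) (h t _)

/-- The regret is at most the accumulated deviation of the success probabilities and of the
estimates from the Beta means, up to the effect of the reweighting. -/
theorem ae_regret_le (hg : 0 < par.gam) {s : ℝ}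
    (hdist : ∀ r : ℕ → sys.Team → ℝ, (∀ t S, r t S ∈ Set.Icc (0 : ℝ) 1) →
      ∀ S t, |par.lam * sys.dist r S t| ≤ s)
    (hsyn : ∀ S, Real.exp (-s) ≤ sys.synergy S ^ par.eta ∧ sys.synergy S ^ par.eta ≤ 1)
    (opt : ℕ → Ω → sys.Team) :
    ∀ᵐ ω ∂μ, ∀ T, run.regret opt T ω ≤ (Real.exp (3 * s) - 1) * T +
      2 * ∑ S, (∑ t ∈ Finset.range T, |run.theta t ω S - run.mean t S ω| +
        ∑ t ∈ Finset.range T, |run.est t ω S - run.mean t S ω|) := by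
  filter_upwards [run.ae_est_mem hg] with ω hω T
  have hstep : ∀ t, run.theta t ω (opt t ω) - run.theta t ω (run.selected t ω) ≤
      (Real.exp (3 * s) - 1) + 2 * ∑ S, (|run.theta t ω S - run.mean t S ω| +
        |run.est t ω S - run.mean t S ω|) := fun t => by
    have hr : ∀ t S, run.reward t ω S ∈ Set.Icc (0 : ℝ) 1 := fun t S => run.reward_mem t ω S
    have h1 := sys.le_add_of_confidence_le hg (hdist _ hr (opt t ω) t)
      (hdist _ hr (run.selected t ω) t) (hsyn _).1 (hsyn _).2 (hω t _) (hω t _)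
      (run.selected_max t ω (opt t ω))
    -- The bound by a sum over all teams is the same for every `S`, so it applies to the random
    -- teams `opt t ω` and `run.selected t ω`; these two uses give the factor 2.
    have h2 : ∀ S, |run.theta t ω S - run.est t ω S| ≤
        ∑ S, (|run.theta t ω S - run.mean t S ω| + |run.est t ω S - run.mean t S ω|) := fun S => by
      refine le_trans ?_ (Finset.single_le_sum (f := fun S =>
        |run.theta t ω S - run.mean t S ω| + |run.est t ω S - run.mean t S ω|)
        (fun S _ => by positivity) (Finset.mem_univ S))
      rw [abs_sub_comm (run.est t ω S)]
      exact abs_sub_le _ _ _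
    have h3 := (le_abs_self _).trans (h2 (opt t ω))
    have h4 := (neg_le_abs _).trans (h2 (run.selected t ω))
    linarith
  calc run.regret opt T ω ≤ ∑ t ∈ Finset.range T, ((Real.exp (3 * s) - 1) +
        2 * ∑ S, (|run.theta t ω S - run.mean t S ω| + |run.est t ω S - run.mean t S ω|)) :=
        Finset.sum_le_sum fun t _ => hstep t
    _ = _ := by
        rw [Finset.sum_add_distrib, Finset.sum_const, Finset.card_range, nsmul_eq_mul, mul_comm,
          ← Finset.mul_sum, Finset.sum_comm]
        simp_rw [Finset.sum_add_distrib]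

section Rates

variable [IsProbabilityMeasure μ] {u : ℕ → ℝ}

theorem integral_abs_theta_sub_mean_le (hg : 0 < par.gam) {t : ℕ} {S : sys.Team}
    (hu : ∀ ω, 1 / Real.sqrt (run.alpha t S ω + run.beta t S ω) ≤ u t) :
    ∫ ω, |run.theta t ω S - run.mean t S ω| ∂μ ≤ u t :=
  HasCondBetaLaw.integral_abs_sub_le (run.history.le t) (run.measurable_theta t S)
    (run.measurable_alpha t S) (run.measurable_beta t S) (run.theta_law t S)
    (run.alpha_pos hg t S) (run.beta_pos hg t S) hu

theorem integral_abs_est_sub_mean_le (hg : 0 < par.gam) {t : ℕ} {S : sys.Team}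
    (hu : ∀ ω, 1 / Real.sqrt (run.alpha t S ω + run.beta t S ω) ≤ u t) :
    ∫ ω, |run.est t ω S - run.mean t S ω| ∂μ ≤ u t := by
  rcases run.est_cases with h | h
  · exact HasCondBetaLaw.integral_abs_sub_le (run.history.le t) (run.measurable_est' t S)
      (run.measurable_alpha t S) (run.measurable_beta t S) (h t S)
      (run.alpha_pos hg t S) (run.beta_pos hg t S) hu
  · obtain ⟨ω⟩ := μ.nonempty_of_neZero
    simpa [h] using le_trans (by positivity) (hu ω)

theorem ae_eventually_sum_theta_le (hg : 0 < par.gam)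
    (hθ : ∀ t S, Measurable[run.history (t + 1)] fun ω => run.theta t ω S)
    (hu : ∀ t S ω, 1 / Real.sqrt (run.alpha t S ω + run.beta t S ω) ≤ u t) {c L : ℝ} (hc : 0 < c)
    (hsum : ∀ T : ℕ, ∑ t ∈ Finset.range T, u t ≤ c * T + L * Real.sqrt T) :
    ∀ᵐ ω ∂μ, ∀ᶠ T : ℕ in atTop, ∀ S,
      ∑ t ∈ Finset.range T, |run.theta t ω S - run.mean t S ω| ≤ 4 * c * T := by
  simp only [eventually_all]
  exact fun S => ae_eventually_sum_abs_sub_le (fun t => hθ t S) (fun t => run.measurable_alpha t S)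
    (fun t => run.measurable_beta t S) (fun t => run.alpha_pos hg t S)
    (fun t => run.beta_pos hg t S) (fun t => run.theta_law t S) (fun t => hu t S) hc hsum

theorem ae_eventually_sum_est_le (hg : 0 < par.gam)
    (hu : ∀ t S ω, 1 / Real.sqrt (run.alpha t S ω + run.beta t S ω) ≤ u t) {c L : ℝ} (hc : 0 < c)
    (hsum : ∀ T : ℕ, ∑ t ∈ Finset.range T, u t ≤ c * T + L * Real.sqrt T) :
    ∀ᵐ ω ∂μ, ∀ᶠ T : ℕ in atTop, ∀ S,
      ∑ t ∈ Finset.range T, |run.est t ω S - run.mean t S ω| ≤ 4 * c * T := by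
  simp only [eventually_all]
  rcases run.est_cases with h | h
  · exact fun S => ae_eventually_sum_abs_sub_le (fun t => run.measurable_est t S)
      (fun t => run.measurable_alpha t S)
      (fun t => run.measurable_beta t S) (fun t => run.alpha_pos hg t S)
      (fun t => run.beta_pos hg t S) (fun t => h t S) (fun t => hu t S) hc hsum
  · refine fun S => Eventually.of_forall fun ω => Eventually.of_forall fun T => ?_
    simp only [h, sub_self, abs_zero, Finset.sum_const_zero]
    positivity

/-- The expected regret in terms of the accumulated standard deviations. -/
theorem integral_regret_le (hg : 0 < par.gam) {s : ℝ}
    (hdist : ∀ r : ℕ → sys.Team → ℝ, (∀ t S, r t S ∈ Set.Icc (0 : ℝ) 1) →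
      ∀ S t, |par.lam * sys.dist r S t| ≤ s)
    (hsyn : ∀ S, Real.exp (-s) ≤ sys.synergy S ^ par.eta ∧ sys.synergy S ^ par.eta ≤ 1)
    (hu : ∀ t S ω, 1 / Real.sqrt (run.alpha t S ω + run.beta t S ω) ≤ u t)
    {opt : ℕ → Ω → sys.Team} (hopt : ∀ t S, MeasurableSet {ω | opt t ω = S}) (T : ℕ) :
    ∫ ω, run.regret opt T ω ∂μ ≤ (Real.exp (3 * s) - 1) * T +
      4 * Fintype.card sys.Team * ∑ t ∈ Finset.range T, u t := by
  have hmean : ∀ t S, ∀ᵐ ω ∂μ, run.mean t S ω ∈ Set.Icc (0 : ℝ) 1 := fun t S =>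
    Eventually.of_forall (run.mean_mem hg t S)
  have i1 : ∀ t S, Integrable (fun ω => |run.theta t ω S - run.mean t S ω|) μ := fun t S =>
    integrable_abs_sub (run.measurable_theta t S) (run.measurable_mean t S)
      (run.ae_theta_mem.mono fun ω h => h t S) (hmean t S)
  have i2 : ∀ t S, Integrable (fun ω => |run.est t ω S - run.mean t S ω|) μ := fun t S =>
    integrable_abs_sub (run.measurable_est' t S) (run.measurable_mean t S)
      ((run.ae_est_mem hg).mono fun ω h => h t S) (hmean t S)
  have i3 : ∀ S, Integrable (fun ω => ∑ t ∈ Finset.range T, |run.theta t ω S - run.mean t S ω|) μ :=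
    fun S => integrable_finsetSum _ fun t _ => i1 t S
  have i4 : ∀ S, Integrable (fun ω => ∑ t ∈ Finset.range T, |run.est t ω S - run.mean t S ω|) μ :=
    fun S => integrable_finsetSum _ fun t _ => i2 t S
  have i5 : Integrable (fun ω => ∑ S, (∑ t ∈ Finset.range T, |run.theta t ω S - run.mean t S ω| +
        ∑ t ∈ Finset.range T, |run.est t ω S - run.mean t S ω|)) μ :=
    integrable_finsetSum _ fun S _ => (i3 S).add (i4 S)
  calc _ ≤ ∫ ω, ((Real.exp (3 * s) - 1) * T +
      2 * ∑ S, (∑ t ∈ Finset.range T, |run.theta t ω S - run.mean t S ω| +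
        ∑ t ∈ Finset.range T, |run.est t ω S - run.mean t S ω|)) ∂μ :=
        integral_mono_ae (run.integrable_regret hopt T)
          ((integrable_const _).add (i5.const_mul 2))
          ((run.ae_regret_le hg hdist hsyn opt).mono fun ω h => h T)
    _ = (Real.exp (3 * s) - 1) * T +
      2 * ∑ S, (∑ t ∈ Finset.range T, ∫ ω, |run.theta t ω S - run.mean t S ω| ∂μ +
        ∑ t ∈ Finset.range T, ∫ ω, |run.est t ω S - run.mean t S ω| ∂μ) := by
        rw [integral_add (integrable_const _) (i5.const_mul 2)]
        congr 1
        · simp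
        · rw [integral_const_mul, integral_finsetSum]
          swap
          · exact fun S _ => (i3 S).add (i4 S)
          congr 1
          refine Finset.sum_congr rfl fun S _ => ?_
          rw [integral_add (i3 S) (i4 S), integral_finsetSum _ fun t _ => i1 t S,
            integral_finsetSum _ fun t _ => i2 t S]
    _ ≤ (Real.exp (3 * s) - 1) * T +
      2 * ∑ _S : sys.Team, (∑ t ∈ Finset.range T, u t + ∑ t ∈ Finset.range T, u t) := by
        gcongr with S _ t _ t _
        · exact run.integral_abs_theta_sub_mean_le hg (hu t S)
        · exact run.integral_abs_est_sub_mean_le hg (hu t S)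
    _ = _ := by
        rw [Finset.sum_const, Finset.card_univ, nsmul_eq_mul]
        ring

/-- The almost sure growth rate of the regret. -/
theorem ae_eventually_regret_le (hg : 0 < par.gam) {s : ℝ}
    (hdist : ∀ r : ℕ → sys.Team → ℝ, (∀ t S, r t S ∈ Set.Icc (0 : ℝ) 1) →
      ∀ S t, |par.lam * sys.dist r S t| ≤ s)
    (hsyn : ∀ S, Real.exp (-s) ≤ sys.synergy S ^ par.eta ∧ sys.synergy S ^ par.eta ≤ 1)
    (hθ : ∀ t S, Measurable[run.history (t + 1)] fun ω => run.theta t ω S)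
    (hu : ∀ t S ω, 1 / Real.sqrt (run.alpha t S ω + run.beta t S ω) ≤ u t) {c L : ℝ} (hc : 0 < c)
    (hsum : ∀ T : ℕ, ∑ t ∈ Finset.range T, u t ≤ c * T + L * Real.sqrt T)
    (opt : ℕ → Ω → sys.Team) :
    ∀ᵐ ω ∂μ, ∀ᶠ T : ℕ in atTop, run.regret opt T ω ≤
      (Real.exp (3 * s) - 1 + 16 * Fintype.card sys.Team * c) * T := by
  filter_upwards [run.ae_regret_le hg hdist hsyn opt, run.ae_eventually_sum_theta_le hg hθ hu hc hsum,
    run.ae_eventually_sum_est_le hg hu hc hsum] with ω h1 h2 h3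
  filter_upwards [h2, h3] with T h2 h3
  calc _ ≤ _ := h1 T
    _ ≤ (Real.exp (3 * s) - 1) * T + 2 * ∑ _S : sys.Team, (4 * c * T + 4 * c * T) := by
        gcongr with S _
        · exact h2 S
        · exact h3 S
    _ = _ := by
        rw [Finset.sum_const, Finset.card_univ, nsmul_eq_mul]
        ring

end Rates

end Run

end KABB

/-! ### Choice of the parameters and conclusion. -/

/-- The benchmark `opt` is arbitrary: a fixed team `S*`, or the best team of every round. The
constant `K` depends neither on `ε` nor on the parameters, the run or the benchmark. -/
theorem mainTheorem2 {E C : Type*} [Fintype E] [DecidableEq E] [Fintype C] [DecidableEq C]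
    (sys : KABB.System E C) :
    ∃ K : ℝ, ∀ ε : ℝ, 0 < ε → ∃ par : KABB.Params,
      0 < par.lam ∧ 0 ≤ par.eta ∧ ((∀ S, 0 < sys.synergy S) → 0 < par.eta) ∧
      0 < par.gam ∧ par.gam < 1 ∧
      ∀ (rule : KABB.Rule) {Ω : Type*} {mΩ : MeasurableSpace Ω} (μ : Measure Ω)
        [IsProbabilityMeasure μ] (run : KABB.Run sys par rule μ) (opt : ℕ → Ω → sys.Team),
        (∀ t S, MeasurableSet {ω | opt t ω = S}) →
        (∀ T : ℕ, 2 ≤ T →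
          Integrable (run.regret opt T) μ ∧
          ∫ ω, run.regret opt T ω ∂μ ≤ ε * T + K * Real.sqrt (T * Real.log T)) ∧
        ((∀ t S, Measurable[run.history (t + 1)] fun ω => run.theta t ω S) →
          ∀ᵐ ω ∂μ, ∀ᶠ T : ℕ in atTop,
            run.regret opt T ω ≤ ε * T + K * Real.sqrt (T * Real.log T)) := by
  obtain ⟨c₀, hc₀, hc₀S⟩ := sys.exists_pos_le (fun S => sys.alpha0 S + sys.beta0 S)
    fun S => add_pos (sys.alpha0_pos S) (sys.beta0_pos S)
  obtain ⟨B, hB0, hB⟩ := sys.exists_abs_dist_le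
  -- A lower bound for both the initial weight and the increment of each round.
  set c := min c₀ 1
  have hc : 0 < c := lt_min hc₀ one_pos
  set k := Real.sqrt (2 / c)
  have hk : 0 < k := Real.sqrt_pos.2 (by positivity)
  set n : ℝ := (Fintype.card sys.Team : ℝ) with hn
  have hn0 : 0 < n := by exact Nat.cast_pos.2 Fintype.card_pos
  -- In expectation the `√T` term has coefficient `4 n · 2 k`, doubled by `√T ≤ 2 √(T log T)`.
  refine ⟨16 * n * k, fun ε hε => ?_⟩
  set s := Real.log (1 + ε / 2) / 3 with hs_def
  have hs : 0 < s := div_pos (Real.log_pos (by linarith)) three_pos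
  have hexp : Real.exp (3 * s) - 1 = ε / 2 := by
    rw [hs_def, mul_div_cancel₀ _ three_ne_zero, Real.exp_log (by linarith)]
    ring
  obtain ⟨η, hη0, hη, hsyn⟩ := sys.exists_synergy_exponent hs
  -- The factor 16 is dictated by the almost sure bound; the expectation would only need 4.
  obtain ⟨M, hM1, hM⟩ : ∃ M : ℕ, 1 ≤ M ∧ 16 * n * (k / Real.sqrt M) ≤ ε / 2 := by
    obtain ⟨M, hM⟩ := exists_nat_ge (max 1 ((32 * n * k / ε) ^ 2))
    have hM1 : (1 : ℝ) ≤ M := (le_max_left _ _).trans hM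
    refine ⟨M, by exact_mod_cast hM1, ?_⟩
    have h1 : 32 * n * k / ε ≤ Real.sqrt M :=
      Real.le_sqrt_of_sq_le ((le_max_right _ _).trans hM)
    have h2 : 0 < Real.sqrt M := Real.sqrt_pos.2 (by linarith)
    rw [div_le_iff₀ hε] at h1
    rw [mul_div_assoc', div_le_iff₀ h2]
    linarith
  have hM1' : (1 : ℝ) ≤ M := by exact_mod_cast hM1
  have hMpos : 0 < Real.sqrt M := Real.sqrt_pos.2 (by linarith)
  have hq : 1 / (2 * (M : ℝ)) < 1 := by rw [div_lt_one (by positivity)]; linarith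
  have hq' : 0 < 1 / (2 * (M : ℝ)) := by positivity
  obtain ⟨g, hg0, hg1, hgq⟩ := sys.exists_gam (q := 1 - 1 / (2 * (M : ℝ)))
    (by linarith) (by linarith)
  -- `B + 1` instead of `B`, since `B` may be zero.
  refine ⟨⟨s / (B + 1), η, g⟩, by positivity, hη0, hη, hg0, hg1, ?_⟩
  intro rule Ω mΩ μ _ run opt hopt
  have hdist : ∀ r : ℕ → sys.Team → ℝ, (∀ t S, r t S ∈ Set.Icc (0 : ℝ) 1) →
      ∀ S t, |s / (B + 1) * sys.dist r S t| ≤ s := fun r hr S t => by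
    rw [abs_mul, abs_of_pos (by positivity), div_mul_eq_mul_div, div_le_iff₀ (by linarith)]
    exact mul_le_mul_of_nonneg_left (by linarith [hB r hr S t]) hs.le
  set u : ℕ → ℝ := fun t => k * (1 / Real.sqrt ((t : ℝ) + 1) + 1 / Real.sqrt M) with hu_def
  have hu : ∀ t S ω, 1 / Real.sqrt (run.alpha t S ω + run.beta t S ω) ≤ u t := fun t S ω =>
    KABB.one_div_sqrt_le_of_geom_sum_le hM1 hc t
      (sys.geom_sum_le_alpha_add_beta hc (min_le_right _ _) (by linarith) hgq S
        ((min_le_left _ _).trans (hc₀S S)) t)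
  have hsum : ∀ T : ℕ, ∑ t ∈ Finset.range T, u t ≤ k / Real.sqrt M * T + 2 * k * Real.sqrt T :=
    fun T => by
      rw [hu_def, ← Finset.mul_sum, Finset.sum_add_distrib, Finset.sum_const, Finset.card_range,
        nsmul_eq_mul]
      have := mul_le_mul_of_nonneg_left (KABB.sum_one_div_sqrt_le T) hk.le
      calc _ = k * ∑ t ∈ Finset.range T, 1 / Real.sqrt ((t : ℝ) + 1) + k / Real.sqrt M * T := by ring
        _ ≤ _ := by linarith
  refine ⟨fun T hT => ⟨run.integrable_regret hopt T, ?_⟩, fun hθ => ?_⟩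
  · have h1 := run.integral_regret_le hg0 hdist hsyn hu hopt T
    rw [hexp, ← hn] at h1
    have h2 := mul_le_mul_of_nonneg_left (hsum T) (by positivity : 0 ≤ 4 * n)
    have h3 := mul_le_mul_of_nonneg_left (KABB.sqrt_le_two_mul_sqrt_mul_log hT)
      (by positivity : 0 ≤ 8 * n * k)
    have h4 := mul_le_mul_of_nonneg_right hM (Nat.cast_nonneg (α := ℝ) T)
    have h5 : 0 ≤ n * (k / Real.sqrt M) * T := by positivity
    linarith
  · filter_upwards [run.ae_eventually_regret_le hg0 hdist hsyn hθ hu (by positivity) hsum opt]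
      with ω hω
    filter_upwards [hω] with T hT
    rw [hexp, ← hn] at hT
    have h4 := mul_le_mul_of_nonneg_right hM (Nat.cast_nonneg (α := ℝ) T)
    -- Almost surely the linear term already suffices for large `T`; the `K` term is only slack.
    have h5 : 0 ≤ 16 * n * k * Real.sqrt (T * Real.log T) := by positivity
    linarith
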